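/- Let $K$ be a field of characteristic zero. For $m,n,r\in\mathbb N$ let $U_{ik}$ ($1\le i\le m$, $1\le k\le r$) and $V_{jk}$ ($1\le j\le n$, $1\le k\le r$) be algebraically independent transcendentals over $K$, and put $X_{ij}=\sum_{k=1}^r U_{ik}V_{jk}$. The determinantal matroid $\mathbf D(m\times n,r)$ is the matroid on $[m]\times[n]$ in which $S$ is independent iff the family $(X_{ij})_{(i,j)\in S}$ is algebraically independent over $K$. A set $S\subseteq[m]\times[n]$ is identified with the bipartite graph with row vertices $[m]$, column vertices $[n]$ and edge set $S$; it is called a circuit (basis) graph if $S$ is a circuit (basis) of $\mathbf D(m\times n,r)$, and it is spanned by a basis graph if it contains a basis. Its signature $(k,\ell)$ consists of the numbers of rows and of columns incident to an edge. The matroid $\mathbf D(m\times\mathbb N,r)$ on $[m]\times\mathbb N$ has as circuits the circuits of all $\mathbf D(m\times\nu,r)$, $\nu\in\mathbb N$. Let $B$ be a bipartite graph with $m$ row vertices and $n$ column vertices, let $ij$ (row $i$, column $j$) be an edge of $B$, and let $t\le r$. A $(t,1)$-move over $ij$ removes the edge $ij$, adds a new row vertex $u$ and $t$ new column vertices $v_1,\dots,v_t$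 with all edges $uv_q$, and joins the new vertices to old vertices of the opposite class so that every new vertex gets degree $r+1$ and, for some $q$, $uj$ and $iv_q$ are edges, the old neighbours of $u$ form a proper subset of the neighbours of $i$ in $B$, and the old neighbours of $v_q$ form a proper subset of the neighbours of $j$ in $B$. (1) If $C$ is a circuit graph of $\mathbf D(m\times n,r)$ that is spanned by a basis graph, then every graph obtained from $C$ by a $(t,1)$-move over any edge of $C$ is a circuit graph of $\mathbf D((m+1)\times(n+t),r)$ that is spanned by a basis graph. (2) Let $r\ge1$ and $s\ge0$. It is possible to perform $s$ successive $(r,1)$-moves starting from the complete bipartite graph $K_{r+1,r+1}$. Every graph so obtained, on $m$ row and $n$ column vertices, is a circuit graph of $\mathbf D(m\times n,r)$ that is spanned by a basis graph and has signature $(r+1+s,\ r(s+1)+1)$, that is, signature $(k,\,r(k-r)+1)$ with $k=r+1+s$. (3) The bound $\ell\le r(k-r)+1$ for the signature $(k,\ell)$ of a circuit of $\mathbf D(m\times\mathbb N,r)$ is valid and sharp: every circuit satisfies it, and if $r\ge1$, then for every $k$ with $r+1\le k\le m$ there is a circuit of signature $(k,\,r(k-r)+1)$. -/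

import Mathlib

/-- The entry `X_{ab} = ∑ₖ U_{ak} V_{bk}` of the generic `m × n` matrix of rank at most `r`.
The transcendentals `U_{ak}` and `V_{bk}` are the indeterminates of a polynomial ring over `K`,
indexed by `Sum.inl (a, k)` and `Sum.inr (b, k)`. -/
noncomputable def genericEntry (K : Type*) [Field K] (m n r : ℕ) (e : Fin m × Fin n) :
    MvPolynomial ((Fin m × Fin r) ⊕ (Fin n × Fin r)) K :=
  ∑ k : Fin r, MvPolynomial.X (Sum.inl (e.1, k)) * MvPolynomial.X (Sum.inr (e.2, k))

/-- The determinantal matroid `D(m × n, r)` on the ground set `[m] × [n]`: the algebraic matroid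
over `K` of the family of entries `X_{ab}`, that is, `S` is independent iff the subfamily
`(X_e)_{e ∈ S}` is algebraically independent over `K`. A set `S` of positions is identified with
the bipartite graph with row vertices `Fin m`, column vertices `Fin n` and edge set `S`. -/
noncomputable def detMatroid (K : Type*) [Field K] (m n r : ℕ) : Matroid (Fin m × Fin n) :=
  (AlgebraicIndependent.matroid K
    (MvPolynomial ((Fin m × Fin r) ⊕ (Fin n × Fin r)) K)).comap (genericEntry K m n r)

/-- Sanity check for the definition of the determinantal matroid: its independent sets. -/
theorem detMatroid_indep_iff (K : Type*) [Field K] (m n r : ℕ) (S : Set (Fin m × Fin n)) :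
    (detMatroid K m n r).Indep S ↔
      AlgebraicIndependent K (fun e : S => genericEntry K m n r e) := by
  rw [detMatroid, Matroid.comap_indep_iff, AlgebraicIndependent.matroid_indep_iff]
  constructor
  · rintro ⟨h, hinj⟩
    exact (algebraicIndependent_image hinj).2 h
  · intro h
    have hinj : Set.InjOn (genericEntry K m n r) S := Set.injOn_iff_injective.2 h.injective
    exact ⟨(algebraicIndependent_image hinj).1 h, hinj⟩

/-- `C` is spanned by a basis graph of `M`: it contains a basis of `M`. -/
def SpannedByBasis {α : Type*} (M : Matroid α) (C : Set α) : Prop :=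
  ∃ B, M.IsBase B ∧ B ⊆ C

/-- The signature of a bipartite graph given by its edge set: the numbers of row vertices and of
column vertices that are incident to an edge. -/
noncomputable def signature {α β : Type*} (S : Set (α × β)) : ℕ × ℕ :=
  ((Prod.fst '' S).ncard, (Prod.snd '' S).ncard)

/-- `IsT1Move r t B i j D`: the graph `D` arises from the graph `B` by a `(t,1)`-move over the
edge `ij`. The old vertices are the first `m` rows and the first `n` columns of `D`. The copy of
`K_{1,t}` sits on the new row `Fin.last m` and the new columns `Fin.natAdd n q`, `q : Fin t`. -/
structure IsT1Move (r t : ℕ) {m n : ℕ} (B : Set (Fin m × Fin n)) (i : Fin m) (j : Fin n)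
    (D : Set (Fin (m + 1) × Fin (n + t))) : Prop where
  t_le : t ≤ r
  edge_mem : (i, j) ∈ B
  /-- Among the old vertices, exactly the edge `ij` is removed. -/
  old_edges : ∀ (a : Fin m) (b : Fin n),
    (a.castSucc, Fin.castAdd t b) ∈ D ↔ (a, b) ∈ B ∧ (a, b) ≠ (i, j)
  /-- The new vertices carry a copy of `K_{1,t}`. -/
  new_edges : ∀ q : Fin t, (Fin.last m, Fin.natAdd n q) ∈ D
  degree_new_row : {b | (Fin.last m, b) ∈ D}.ncard = r + 1
  degree_new_col : ∀ q : Fin t, {a | (a, Fin.natAdd n q) ∈ D}.ncard = r + 1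
  /-- The new row is joined to `j`, some new column is joined to `i`, and the neighbours in `B` of
  this row and of this column are properly contained in the neighbourhoods of `i` and `j` in
  `B`. -/
  pair : ∃ q : Fin t,
    (Fin.last m, Fin.castAdd t j) ∈ D ∧ (i.castSucc, Fin.natAdd n q) ∈ D ∧
    {b : Fin n | (Fin.last m, Fin.castAdd t b) ∈ D} ⊂ {b | (i, b) ∈ B} ∧
    {a : Fin m | (a.castSucc, Fin.natAdd n q) ∈ D} ⊂ {a | (a, j) ∈ B}

/-- `IteratedT1Move r t C₀ s C`: the graph `C` arises from `C₀` by `s` successive `(t,1)`-moves,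
each over an arbitrary edge of the current graph. -/
inductive IteratedT1Move (r t : ℕ) {m₀ n₀ : ℕ} (C₀ : Set (Fin m₀ × Fin n₀)) :
    ∀ (_s : ℕ) {m n : ℕ}, Set (Fin m × Fin n) → Prop
  | refl : IteratedT1Move r t C₀ 0 C₀
  | step {s m n : ℕ} {C : Set (Fin m × Fin n)} {i : Fin m} {j : Fin n}
      {D : Set (Fin (m + 1) × Fin (n + t))} :
      IteratedT1Move r t C₀ s C → IsT1Move r t C i j D → IteratedT1Move r t C₀ (s + 1) D

/-- Circuits of `D(m × ℕ, r)`, the direct limit over `ν` of the matroids `D(m × ν, r)`: the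
circuits of the limit are the circuits of all the `D(m × ν, r)`, viewed in `[m] × ℕ`. -/
def IsLimitCircuit (K : Type*) [Field K] (m r : ℕ) (C : Set (Fin m × ℕ)) : Prop :=
  ∃ (ν : ℕ) (C' : Set (Fin m × Fin ν)), (detMatroid K m ν r).IsCircuit C' ∧
    C = Prod.map id (fun b : Fin ν => (b : ℕ)) '' C'

/-! In characteristic zero, algebraic independence is linear independence of differentials. So a
graph is independent iff, at generic points, it carries no stress: no nonzero edge weights `c` with
`∑ b, c a b • V b = 0` at every row and `∑ a, c a b • U a = 0` at every column. To prove
independence any special position will do (`indep_of_stressFree`). A vertex whose neighbours sit at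
linearly independent points carries no stress, so generically a vertex of degree at most `r` can be
peeled off.

The rank is `r (m + n - r)` when `r ≤ m, n`: peeling gives a graph of this size, and
`StressFree.ncard_le` gives the upper bound. Circuits spanned by a basis are then recognised by
having `r (m + n - r) + 1` edges and only independent edge deletions. A move adds `r (t + 1)` edges,
which is exactly the growth of the rank, so what remains is to delete one edge of the new graph
(`IsT1Move.indep_sdiff_singleton`). If that edge meets a new vertex, peeling leads back to `C` minus
`ij`. If it is old, placing `u` at `i` and `v` at `j` lets `uv` be exchanged for `ij`
(`StressFree.of_exchange`), and peeling leads back to `C` minus the deleted edge.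

The signature bound is a double count: columns of a circuit have degree at least `r + 1`, and a
circuit has at most `r (k + ℓ - r) + 1` edges. -/

/-! ### The Jacobian criterion in characteristic zero. -/

/-- A derivation into a torsion-free module that vanishes on `T` vanishes everywhere if the ring is
algebraic over the subalgebra generated by `T`. -/
theorem Derivation.eq_zero_of_isAlgebraic_adjoin {K R M : Type*} [Field K] [CharZero K]
    [CommRing R] [IsDomain R] [Algebra K R] [AddCommGroup M] [Module K M] [Module R M]
    [IsScalarTower K R M] [Module.IsTorsionFree R M] (d : Derivation K R M) (T : Set R)
    [Algebra.IsAlgebraic (Algebra.adjoin K T) R] (hT : ∀ t ∈ T, d t = 0) : d = 0 := by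
  have hA : ∀ a ∈ Algebra.adjoin K T, d a = 0 := fun a ha =>
    Derivation.eqOn_adjoin (D1 := d) (D2 := 0) (fun t ht => by simpa using hT t ht) ha
  let D : Derivation (Algebra.adjoin K T) R M :=
    { toFun := d
      map_add' := d.map_add
      map_smul' := fun a y => by
        rw [Algebra.smul_def, d.leibniz]
        have : d (algebraMap (Algebra.adjoin K T) R a) = 0 := hA _ a.2
        rw [this, smul_zero, add_zero, algebraMap_smul]
        rfl
      map_one_eq_zero' := d.map_one_eq_zero
      leibniz' := d.leibniz }
  have : CharZero R := charZero_of_injective_algebraMap (algebraMap K R).injective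
  ext y
  have hy : IsAlgebraic (Algebra.adjoin K T) y := Algebra.IsAlgebraic.isAlgebraic y
  -- For an annihilating polynomial `P` of least degree, `P'(y) ≠ 0` in characteristic zero, while
  -- `0 = D (P(y)) = P'(y) • D y`.
  obtain ⟨P, hPmem, hmin⟩ := WellFounded.has_min
    (measure (Polynomial.natDegree (R := Algebra.adjoin K T))).wf
    {P | P ≠ 0 ∧ Polynomial.aeval y P = 0} hy
  obtain ⟨hP0, hPy⟩ := hPmem
  have hdeg : P.natDegree ≠ 0 := by
    intro h
    rw [Polynomial.eq_C_of_natDegree_eq_zero h] at hPy hP0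
    rw [Polynomial.aeval_C] at hPy
    apply hP0
    rw [(FaithfulSMul.algebraMap_eq_zero_iff _ R).1 hPy, Polynomial.C_0]
  have hder : Polynomial.aeval y (Polynomial.derivative P) ≠ 0 := by
    intro h
    refine hmin _ ⟨?_, h⟩ (Polynomial.natDegree_derivative_lt hdeg)
    intro h0
    exact hdeg (Polynomial.derivative_eq_zero.1 h0)
  have h := D.map_aeval P y
  rw [hPy, D.map_zero] at h
  exact (smul_eq_zero.1 h.symm).resolve_left hder

namespace MvPolynomial

variable {σ K F : Type*} [Field K] [Field F] [Algebra (MvPolynomial σ K) F]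

/-- The total differential of a polynomial, with values in a field containing the polynomials. -/
noncomputable def gradient (F : Type*) [Field F] [Algebra K F] [Algebra (MvPolynomial σ K) F]
    [IsScalarTower K (MvPolynomial σ K) F] :
    Derivation K (MvPolynomial σ K) (σ → F) where
  toFun p s := algebraMap _ F (pderiv s p)
  map_add' p q := by ext; simp
  map_smul' a p := by
    ext s
    simp [Algebra.smul_def, MvPolynomial.algebraMap_eq,
      IsScalarTower.algebraMap_apply K (MvPolynomial σ K) F]
  map_one_eq_zero' := by ext; simp
  leibniz' p q := by
    ext s
    simp [Algebra.smul_def]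

/-- The differentials of algebraically independent polynomials are linearly independent in
characteristic zero. -/
theorem linearIndependent_gradient_of_algebraicIndependent [CharZero K] [Finite σ] [Algebra K F]
    [IsScalarTower K (MvPolynomial σ K) F] [FaithfulSMul (MvPolynomial σ K) F]
    {ι : Type*} {f : ι → MvPolynomial σ K} (hf : AlgebraicIndependent K f) :
    LinearIndependent F (fun i => gradient F (f i)) := by
  classical
  have := Fintype.ofFinite σ
  obtain ⟨T, hsub, hT⟩ := exists_isTranscendenceBasis_superset
    ((algebraicIndependent_subtype_range hf.injective).2 hf)
  have hmk := hT.lift_cardinalMk_eq_trdeg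
  rw [MvPolynomial.trdeg_of_isDomain] at hmk
  have hcard : Nat.card T = Nat.card σ := by
    simpa [Nat.card] using congrArg Cardinal.toNat hmk
  have : Finite T := by
    rw [← Cardinal.mk_lt_aleph0_iff, ← Cardinal.lift_lt_aleph0, hmk]
    simp
  have := Fintype.ofFinite T
  -- Modulo the span `W` of the differentials of `T`, the gradient is a derivation killing a
  -- transcendence basis, hence zero. So `W` contains the differentials of the variables, which form
  -- the standard basis; as `T` has as many elements as `σ`, its differentials form a basis.
  have hspan : ⊤ ≤ Submodule.span F (Set.range fun t : T =>
      gradient (K := K) F (t : MvPolynomial σ K)) := by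
    set W := Submodule.span F (Set.range fun t : T =>
      gradient (K := K) F (t : MvPolynomial σ K))
    have : Algebra.IsAlgebraic (Algebra.adjoin K T) (MvPolynomial σ K) := by
      have := hT.isAlgebraic
      rwa [Subtype.range_coe] at this
    have : Module.IsTorsionFree (MvPolynomial σ K) ((σ → F) ⧸ W) :=
      Module.IsTorsionFree.trans_faithfulSMul (MvPolynomial σ K) F _
    have hd := Derivation.eq_zero_of_isAlgebraic_adjoin (R := MvPolynomial σ K)
      ((W.mkQ.restrictScalars (MvPolynomial σ K)).compDer (gradient (K := K) F)) T (fun t ht => by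
        have h : gradient (K := K) F t ∈ W := Submodule.subset_span ⟨⟨t, ht⟩, rfl⟩
        simpa using h)
    intro v _
    rw [pi_eq_sum_univ v]
    refine Submodule.sum_mem _ fun s _ => Submodule.smul_mem _ _ ?_
    have h := DFunLike.congr_fun hd (X s)
    have h2 : gradient (K := K) F (X s) ∈ W := by simpa using h
    convert h2 using 1
    ext s'
    simp [gradient, pderiv_X, Pi.single_apply]
  have hli := linearIndependent_of_top_le_span_of_card_eq_finrank hspan (by
    simpa [Nat.card_eq_fintype_card] using hcard)
  exact hli.comp (fun i => (⟨f i, hsub ⟨i, rfl⟩⟩ : T)) fun i j h => hf.injective (by simpa using h)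

/-- Polynomials whose differentials are linearly independent at some point, with coordinates in
any extension field, are algebraically independent in characteristic zero. -/
theorem algebraicIndependent_of_linearIndependent_pderiv [CharZero K] [Finite σ]
    {E : Type*} [Field E] [Algebra K E] {ι : Type*} [Finite ι] {f : ι → MvPolynomial σ K} (p : σ → E)
    (h : LinearIndependent E (fun i s => aeval p (pderiv s (f i)))) :
    AlgebraicIndependent K f := by
  classical
  have := Fintype.ofFinite σ
  have := Fintype.ofFinite ι
  set M : Matrix ι σ (MvPolynomial σ K) := Matrix.of fun i s => pderiv s (f i) with hM
  -- A right inverse of the Jacobian matrix at `p`. The product `MN` of the polynomial Jacobian with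
  -- this constant matrix is the identity at `p`, so its determinant is a nonzero polynomial.
  obtain ⟨N, hN⟩ : ∃ N : Matrix σ ι E, M.map (aeval p) * N = 1 := by
    obtain ⟨g, hg⟩ := LinearMap.exists_leftInverse_of_injective
      (Fintype.linearCombination E fun i s => aeval p (pderiv s (f i)))
      (LinearMap.ker_eq_bot.2 (linearIndependent_iff_injective_fintypeLinearCombination.1 h))
    refine ⟨(LinearMap.toMatrix' g).transpose, ?_⟩
    ext i j
    have h1 := congrFun (LinearMap.congr_fun hg (Pi.single i 1)) j
    rw [LinearMap.comp_apply, Fintype.linearCombination_apply_single, one_smul,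
      ← LinearMap.toMatrix'_mulVec] at h1
    simpa [Matrix.mulVec, dotProduct, Matrix.mul_apply, mul_comm, Matrix.one_apply,
      Pi.single_apply, eq_comm, hM] using h1
  set MN : Matrix ι ι (MvPolynomial σ E) :=
    (M.map (map (algebraMap K E)) : Matrix ι σ (MvPolynomial σ E)) *
      (N.map C : Matrix σ ι (MvPolynomial σ E)) with hMN
  have hdet : MN.det ≠ 0 := by
    intro h0
    have h1 := congrArg (eval p) h0
    rw [RingHom.map_det, map_zero] at h1
    have h2 : (eval p).mapMatrix MN = 1 := by
      rw [hMN, ← hN]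
      ext i j
      simp only [RingHom.mapMatrix_apply, Matrix.map_apply, Matrix.mul_apply, map_sum, map_mul,
        eval_map, eval_C, aeval_def]
    rw [h2, Matrix.det_one] at h1
    exact one_ne_zero h1
  -- By the chain rule, a relation `P` gives a row vector of the `(∂ᵢP)(f)` killed by the Jacobian,
  -- hence by `MN`. The partial derivatives are therefore relations too, and induction on the degree
  -- leaves only constants.
  have key : ∀ P : MvPolynomial ι K, aeval f P = 0 → ∀ i, aeval f (pderiv i P) = 0 := by
    intro P hP i
    have hchain : ∀ s, ∑ i, aeval f (pderiv i P) * M i s = 0 := by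
      intro s
      have h1 : pderiv s (aeval f P) = ∑ i, aeval f (pderiv i P) * M i s := by
        clear hP
        induction P using MvPolynomial.induction_on with
        | C a => simp
        | add P Q hP hQ => simp only [map_add, hP, hQ, add_mul, Finset.sum_add_distrib]
        | mul_X P j hP =>
          simp only [map_mul, aeval_X, pderiv_mul, hP, map_add, pderiv_X, add_mul,
            Finset.sum_add_distrib, Finset.sum_mul]
          congr 1
          · exact Finset.sum_congr rfl fun i _ => by ring
          · simp [Pi.single_apply, hM, apply_ite, ite_mul]
      rw [← h1, hP, map_zero]
    have hv : Matrix.vecMul (fun i => map (algebraMap K E) (aeval f (pderiv i P))) MN = 0 := by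
      rw [hMN, ← Matrix.vecMul_vecMul]
      have h1 : Matrix.vecMul (fun i => map (algebraMap K E) (aeval f (pderiv i P)))
          (M.map (map (algebraMap K E)) : Matrix ι σ (MvPolynomial σ E)) = 0 := by
        ext1 s
        have := congrArg (map (algebraMap K E)) (hchain s)
        simp only [map_sum, map_mul, map_zero] at this
        exact this
      rw [h1, Matrix.zero_vecMul]
    have h0 := congrFun (Matrix.eq_zero_of_vecMul_eq_zero hdet hv) i
    exact map_injective _ (algebraMap K E).injective (by simpa using h0)
  rw [algebraicIndependent_iff]
  suffices ∀ d, ∀ P : MvPolynomial ι K, P.totalDegree ≤ d → aeval f P = 0 → P = 0 from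
    fun P hP => this _ P le_rfl hP
  intro d
  induction d with
  | zero =>
    intro P hd hP
    rw [totalDegree_eq_zero_iff_eq_C.1 (Nat.le_zero.1 hd)] at hP ⊢
    simpa using hP
  | succ d ih =>
    intro P hd hP
    have h0 : ∀ i, pderiv i P = 0 := fun i => ih _ (by
      refine Finset.sup_le fun m hm => ?_
      rw [mem_support_iff, coeff_pderiv] at hm
      have h1 := le_totalDegree (mem_support_iff.2 (left_ne_zero_of_mul hm))
      rw [Finsupp.sum_add_index' (fun _ => rfl) (fun _ _ _ => rfl),
        Finsupp.sum_single_index rfl] at h1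
      exact Nat.le_of_succ_le_succ (h1.trans hd)) (key P hP i)
    have hC : P = C (coeff 0 P) := by
      ext m
      by_cases hm : m = 0
      · simp [hm]
      · obtain ⟨i, hi⟩ := Finsupp.ne_iff.1 hm
        have h1 := coeff_pderiv (i := i) P (m - Finsupp.single i 1)
        have hle : Finsupp.single i 1 ≤ m := by
          simpa [Nat.one_le_iff_ne_zero] using hi
        rw [h0, coeff_zero, tsub_add_cancel_of_le hle] at h1
        rw [coeff_C, if_neg (Ne.symm hm)]
        exact (mul_eq_zero.1 h1.symm).resolve_right (Nat.cast_add_one_ne_zero _)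
    rw [hC] at hP ⊢
    simpa using hP

end MvPolynomial

/-! ### Stresses on bipartite graphs and the transfer between independence and stress-freeness. -/

/-- There is no nonzero equilibrium stress on the bipartite graph `S` placed at the points `U` and
`V`, that is, no nontrivial linear relation between the differentials of `⟨U a, V b⟩` for the
edges `(a, b)` of `S`. -/
def StressFree {α β κ F : Type*} [Field F] [Fintype α] [Fintype β] (U : α → κ → F) (V : β → κ → F)
    (S : Set (α × β)) : Prop :=
  ∀ c : α → β → F, (∀ a b, (a, b) ∉ S → c a b = 0) → (∀ a, ∑ b, c a b • V b = 0) →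
    (∀ b, ∑ a, c a b • U a = 0) → c = 0

/-- The differential of the bilinear form `⟨U a, V b⟩` at the edge `e = (a, b)`. -/
def edgeDifferential {α β κ F : Type*} [Field F] [DecidableEq α] [DecidableEq β] (U : α → κ → F)
    (V : β → κ → F) (e : α × β) : (α × κ) ⊕ (β × κ) → F :=
  Sum.elim (fun x => if x.1 = e.1 then V e.2 x.2 else 0) fun x => if x.1 = e.2 then U e.1 x.2 else 0

theorem linearIndependent_edgeDifferential_iff {α β κ F : Type*} [Field F] [Fintype α] [Fintype β]
    [DecidableEq α] [DecidableEq β] (U : α → κ → F) (V : β → κ → F) (S : Set (α × β)) :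
    LinearIndependent F (fun e : S => edgeDifferential U V e) ↔ StressFree U V S := by
  classical
  have key : ∀ c : α → β → F, (∀ a b, (a, b) ∉ S → c a b = 0) →
      (∑ e : S, c e.1.1 e.1.2 • edgeDifferential U V e = 0 ↔
        (∀ a, ∑ b, c a b • V b = 0) ∧ ∀ b, ∑ a, c a b • U a = 0) := by
    intro c hc
    have h1 : ∑ e : S, c e.1.1 e.1.2 • edgeDifferential U V e =
        ∑ a, ∑ b, c a b • edgeDifferential U V (a, b) := by
      rw [← Fintype.sum_prod_type' (f := fun a b => c a b • edgeDifferential U V (a, b)),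
        Finset.sum_set_coe S (f := fun e : α × β => c e.1 e.2 • edgeDifferential U V e)]
      refine Finset.sum_subset (Finset.subset_univ _) fun e _ he => ?_
      rw [hc e.1 e.2 (by simpa using he), zero_smul]
    rw [h1]
    constructor
    · intro h
      constructor
      · intro a
        ext k
        simpa [edgeDifferential, Finset.sum_ite_irrel, mul_ite] using congrFun h (Sum.inl (a, k))
      · intro b
        ext k
        simpa [edgeDifferential, mul_ite] using congrFun h (Sum.inr (b, k))
    · rintro ⟨hV, hU⟩
      ext (⟨a, k⟩ | ⟨b, k⟩)
      · simpa [edgeDifferential, Finset.sum_ite_irrel, mul_ite] using congrFun (hV a) k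
      · simpa [edgeDifferential, mul_ite] using congrFun (hU b) k
  rw [Fintype.linearIndependent_iff]
  constructor
  · intro h c hc hV hU
    have h1 := h (fun e => c e.1.1 e.1.2) ((key c hc).2 ⟨hV, hU⟩)
    ext a b
    by_cases hab : (a, b) ∈ S
    · exact h1 ⟨_, hab⟩
    · exact hc a b hab
  · intro h g hg e
    set c : α → β → F := fun a b => if h : (a, b) ∈ S then g ⟨(a, b), h⟩ else 0 with hcdef
    have hc : ∀ a b, (a, b) ∉ S → c a b = 0 := fun a b h => dif_neg h
    have hcg : ∀ e : S, c e.1.1 e.1.2 = g e := fun e => dif_pos e.2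
    have h1 := (key c hc).1 (by simpa only [hcg] using hg)
    rw [← hcg, h c hc h1.1 h1.2]
    rfl

section Generic

variable (K : Type*) [Field K] (m n r : ℕ)

/-- The function field of the generic `m × r` and `n × r` matrices. -/
abbrev GenericField : Type _ := FractionRing (MvPolynomial ((Fin m × Fin r) ⊕ (Fin n × Fin r)) K)

/-- The rows of the generic `m × r` matrix. -/
noncomputable def genericU (a : Fin m) (k : Fin r) : GenericField K m n r :=
  algebraMap (MvPolynomial ((Fin m × Fin r) ⊕ (Fin n × Fin r)) K) _ (MvPolynomial.X (Sum.inl (a, k)))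

/-- The rows of the generic `n × r` matrix. -/
noncomputable def genericV (b : Fin n) (k : Fin r) : GenericField K m n r :=
  algebraMap (MvPolynomial ((Fin m × Fin r) ⊕ (Fin n × Fin r)) K) _ (MvPolynomial.X (Sum.inr (b, k)))

variable {K m n r}

theorem pderiv_genericEntry (e : Fin m × Fin n) (s : (Fin m × Fin r) ⊕ (Fin n × Fin r)) :
    MvPolynomial.pderiv s (genericEntry K m n r e) =
      Sum.elim (fun x => if x.1 = e.1 then MvPolynomial.X (Sum.inr (e.2, x.2)) else 0)
        (fun x => if x.1 = e.2 then MvPolynomial.X (Sum.inl (e.1, x.2)) else 0) s := by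
  rcases s with ⟨a, k⟩ | ⟨b, k⟩
  · simp [genericEntry, MvPolynomial.pderiv_X, Pi.single_apply, ite_and, eq_comm]
  · simp [genericEntry, MvPolynomial.pderiv_X, Pi.single_apply, ite_and, eq_comm]

theorem stressFree_of_indep [CharZero K] {S : Set (Fin m × Fin n)}
    (hS : (detMatroid K m n r).Indep S) :
    StressFree (genericU K m n r) (genericV K m n r) S := by
  rw [detMatroid_indep_iff] at hS
  rw [← linearIndependent_edgeDifferential_iff]
  have h := MvPolynomial.linearIndependent_gradient_of_algebraicIndependent
    (F := GenericField K m n r) hS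
  convert h using 2 with e
  ext s
  simp only [MvPolynomial.gradient, edgeDifferential, Derivation.mk_coe]
  change _ = algebraMap _ (GenericField K m n r) (MvPolynomial.pderiv s (genericEntry K m n r e))
  rw [pderiv_genericEntry]
  rcases s with ⟨a, k⟩ | ⟨b, k⟩ <;> dsimp only [Sum.elim_inl, Sum.elim_inr] <;> split_ifs <;>
    simp [genericU, genericV]

/-- The points may be non-generic, since a minor that is nonzero at one point is a nonzero
polynomial. This freedom is what permits coinciding vertices in the treatment of moves. -/
theorem indep_of_stressFree [CharZero K] {E : Type*} [Field E] [Algebra K E]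
    {U : Fin m → Fin r → E} {V : Fin n → Fin r → E} {S : Set (Fin m × Fin n)}
    (hS : StressFree U V S) : (detMatroid K m n r).Indep S := by
  classical
  rw [detMatroid_indep_iff]
  rw [← linearIndependent_edgeDifferential_iff] at hS
  refine MvPolynomial.algebraicIndependent_of_linearIndependent_pderiv
    (Sum.elim (fun x => U x.1 x.2) fun x => V x.1 x.2) ?_
  convert hS using 2 with e
  ext s
  rw [pderiv_genericEntry]
  rcases s with ⟨a, k⟩ | ⟨b, k⟩ <;> dsimp only [edgeDifferential, Sum.elim_inl, Sum.elim_inr] <;>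
    split_ifs <;> simp

/-- The rows of a matrix of distinct indeterminates are linearly independent if there are at least
as many columns. -/
theorem linearIndependent_of_injective_X {σ A κ F : Type*} [Fintype A] [Fintype κ] [Field F]
    [Algebra (MvPolynomial σ K) F] [FaithfulSMul (MvPolynomial σ K) F] (x : A × κ → σ)
    (hx : x.Injective) (hcard : Fintype.card A ≤ Fintype.card κ) :
    LinearIndependent F (fun a k => algebraMap (MvPolynomial σ K) F (MvPolynomial.X (x (a, k)))) := by
  classical
  -- Choosing `|A|` of the columns leaves a square matrix of distinct indeterminates, whose
  -- determinant is nonzero.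
  obtain ⟨φ⟩ := Function.Embedding.nonempty_of_card_le hcard
  refine LinearIndependent.of_comp (LinearMap.funLeft F F φ) ?_
  have hy : Function.Injective fun p : A × A => x (p.1, φ p.2) := fun p q h => by
    have h1 := hx h
    rw [Prod.mk.injEq] at h1
    exact Prod.ext h1.1 (φ.injective h1.2)
  have hmap : Function.Injective ((algebraMap (MvPolynomial σ K) F).comp
      (MvPolynomial.rename (R := K) fun p : A × A => x (p.1, φ p.2)).toRingHom) :=
    (FaithfulSMul.algebraMap_injective _ F).comp (MvPolynomial.rename_injective _ hy)
  have hdet := (map_ne_zero_iff _ hmap).2 (Matrix.det_mvPolynomialX_ne_zero A K)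
  rw [RingHom.map_det] at hdet
  have h := Matrix.linearIndependent_rows_of_det_ne_zero hdet
  have heq : (LinearMap.funLeft F F φ ∘
      fun a k => algebraMap (MvPolynomial σ K) F (MvPolynomial.X (x (a, k)))) =
      (((algebraMap (MvPolynomial σ K) F).comp (MvPolynomial.rename (R := K)
        fun p : A × A => x (p.1, φ p.2)).toRingHom).mapMatrix (Matrix.mvPolynomialX A A K)).row := by
    ext a a'
    simp [LinearMap.funLeft]
  rw [heq]
  exact h

/-- At most `r` distinct rows of the generic `m × r` matrix are linearly independent. -/
theorem linearIndepOn_genericU {A : Set (Fin m)} (hA : A.ncard ≤ r) :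
    LinearIndepOn (GenericField K m n r) (genericU K m n r) A := by
  have := Fintype.ofFinite A
  exact linearIndependent_of_injective_X (fun p : A × Fin r => Sum.inl (p.1.1, p.2))
    (fun p q h => by simpa [Prod.ext_iff, Subtype.ext_iff] using h)
    (by rwa [← Nat.card_eq_fintype_card, Fintype.card_fin, Nat.card_coe_set_eq])

/-- At most `r` distinct rows of the generic `n × r` matrix are linearly independent. -/
theorem linearIndepOn_genericV {A : Set (Fin n)} (hA : A.ncard ≤ r) :
    LinearIndepOn (GenericField K m n r) (genericV K m n r) A := by
  have := Fintype.ofFinite A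
  exact linearIndependent_of_injective_X (fun p : A × Fin r => Sum.inr (p.1.1, p.2))
    (fun p q h => by simpa [Prod.ext_iff, Subtype.ext_iff] using h)
    (by rwa [← Nat.card_eq_fintype_card, Fintype.card_fin, Nat.card_coe_set_eq])

theorem genericEntry_prodMap {m' n' : ℕ} (f : Fin m → Fin m') (g : Fin n → Fin n')
    (e : Fin m × Fin n) : genericEntry K m' n' r (Prod.map f g e) =
      MvPolynomial.rename (Sum.map (Prod.map f (id : Fin r → Fin r)) (Prod.map g (id : Fin r → Fin r)))
        (genericEntry K m n r e) := by
  simp [genericEntry]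

/-- The determinantal matroid of a submatrix is a restriction of the determinantal matroid. -/
theorem detMatroid_indep_image_iff {m' n' : ℕ} {f : Fin m → Fin m'} (hf : f.Injective)
    {g : Fin n → Fin n'} (hg : g.Injective) (S : Set (Fin m × Fin n)) :
    (detMatroid K m' n' r).Indep (Prod.map f g '' S) ↔ (detMatroid K m n r).Indep S := by
  have hinj : Function.Injective
      (Sum.map (Prod.map f (id : Fin r → Fin r)) (Prod.map g (id : Fin r → Fin r))) :=
    (hf.prodMap Function.injective_id).sumMap (hg.prodMap Function.injective_id)
  have h1 := algebraicIndependent_equiv (R := K) (Equiv.Set.image _ S (hf.prodMap hg))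
    (f := fun e : Prod.map f g '' S => genericEntry K m' n' r e)
  have h2 := AlgHom.algebraicIndependent_iff (R := K) (x := fun e : S => genericEntry K m n r e)
    (MvPolynomial.rename _) (MvPolynomial.rename_injective _ hinj)
  have h3 : (fun e : Prod.map f g '' S => genericEntry K m' n' r e) ∘
      (Equiv.Set.image _ S (hf.prodMap hg)) = (MvPolynomial.rename (Sum.map
        (Prod.map f (id : Fin r → Fin r)) (Prod.map g (id : Fin r → Fin r)))) ∘
          fun e : S => genericEntry K m n r e := by
    ext1 e
    exact genericEntry_prodMap f g e
  rw [h3] at h1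
  rw [detMatroid_indep_iff, detMatroid_indep_iff]
  exact h1.symm.trans h2

end Generic

theorem LinearIndepOn.eq_zero_of_sum_smul_eq_zero {ι R M : Type*} [Fintype ι] [Ring R]
    [AddCommGroup M] [Module R M] {v : ι → M} {s : Set ι} (h : LinearIndepOn R v s) {g : ι → R}
    (hg : ∀ i ∉ s, g i = 0) (hsum : ∑ i, g i • v i = 0) : g = 0 := by
  classical
  have h1 := linearIndepOn_iff'.1 h s.toFinset g (by simp) (by
    rw [← hsum]
    exact Finset.sum_subset (Finset.subset_univ _) fun i _ hi => by
      rw [hg i (by simpa using hi), zero_smul])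
  ext i
  by_cases hi : i ∈ s
  · exact h1 i (by simpa using hi)
  · exact hg i hi

/-! ### Peeling, exchange and the edge bound for stress-free graphs. -/

namespace StressFree

variable {α β κ F : Type*} [Field F] [Fintype α] [Fintype β] {U U' : α → κ → F} {V V' : β → κ → F}
  {S S' : Set (α × β)}

theorem empty : StressFree U V (∅ : Set (α × β)) := fun c hc _ _ => by
  ext a b
  exact hc a b (Set.notMem_empty _)

theorem mono (h : StressFree U V S') (hS : S ⊆ S') : StressFree U V S := fun c hc hV hU =>
  h c (fun a b hab => hc a b fun h => hab (hS h)) hV hU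

/-- Only the positions of vertices incident to `S` matter; this allows a return from a special
position to the generic one once the moved vertices are gone. -/
theorem congr (h : StressFree U V S) (hU : ∀ e ∈ S, U' e.1 = U e.1)
    (hV : ∀ e ∈ S, V' e.2 = V e.2) : StressFree U' V' S := by
  intro c hc hcV hcU
  refine h c hc (fun a => ?_) (fun b => ?_)
  · rw [← hcV a]
    refine Finset.sum_congr rfl fun b _ => ?_
    by_cases hab : (a, b) ∈ S
    · rw [hV _ hab]
    · rw [hc a b hab, zero_smul, zero_smul]
  · rw [← hcU b]
    refine Finset.sum_congr rfl fun a _ => ?_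
    by_cases hab : (a, b) ∈ S
    · rw [hU _ hab]
    · rw [hc a b hab, zero_smul, zero_smul]

/-- Adding a row vertex whose neighbours are placed at linearly independent points. -/
theorem of_row (u : α) (hu : LinearIndepOn F V {b | (u, b) ∈ S})
    (h : StressFree U V {e ∈ S | e.1 ≠ u}) : StressFree U V S := by
  intro c hc hV hU
  have h0 : c u = 0 := hu.eq_zero_of_sum_smul_eq_zero (fun b hb => hc u b hb) (hV u)
  refine h c (fun a b hab => ?_) hV hU
  by_cases ha : a = u
  · rw [ha, h0, Pi.zero_apply]
  · exact hc a b fun h => hab ⟨h, ha⟩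

/-- Adding a column vertex whose neighbours are placed at linearly independent points. -/
theorem of_col (v : β) (hv : LinearIndepOn F U {a | (a, v) ∈ S})
    (h : StressFree U V {e ∈ S | e.2 ≠ v}) : StressFree U V S := by
  intro c hc hV hU
  have h0 : (fun a => c a v) = 0 :=
    hv.eq_zero_of_sum_smul_eq_zero (fun a ha => hc a v ha) (hU v)
  refine h c (fun a b hab => ?_) hV hU
  by_cases hb : b = v
  · rw [hb]
    exact congrFun h0 a
  · exact hc a b fun h => hab ⟨h, hb⟩

/-- Adding column vertices whose neighbours are placed at linearly independent points. -/
theorem of_cols (T : Set β) (hT : ∀ v ∈ T, LinearIndepOn F U {a | (a, v) ∈ S})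
    (h : StressFree U V {e ∈ S | e.2 ∉ T}) : StressFree U V S := by
  intro c hc hV hU
  refine h c (fun a b hab => ?_) hV hU
  by_cases hb : b ∈ T
  · have h0 : (fun a => c a b) = 0 :=
      (hT b hb).eq_zero_of_sum_smul_eq_zero (fun a ha => hc a b ha) (hU b)
    exact congrFun h0 a
  · exact hc a b fun h => hab ⟨h, hb⟩

/-- Adding row vertices whose neighbours are placed at linearly independent points. -/
theorem of_rows (R : Set α) (hR : ∀ u ∈ R, LinearIndepOn F V {b | (u, b) ∈ S})
    (h : StressFree U V {e ∈ S | e.1 ∉ R}) : StressFree U V S := by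
  intro c hc hV hU
  refine h c (fun a b hab => ?_) hV hU
  by_cases ha : a ∈ R
  · rw [(hR a ha).eq_zero_of_sum_smul_eq_zero (fun b hb => hc a b hb) (hV a), Pi.zero_apply]
  · exact hc a b fun h => hab ⟨h, ha⟩

/-- If `u` is placed at `i` and `v` at `j`, then the differential of `ij` is a combination of those
of `uj`, `iv` and `uv`. -/
theorem of_exchange {u i : α} {v j : β} (hui : u ≠ i) (hvj : v ≠ j) (hU : U u = U i)
    (hV : V v = V j) (huj : (u, j) ∈ S) (hiv : (i, v) ∈ S) (hij : (i, j) ∉ S)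
    (h : StressFree U V (insert (i, j) (S \ {(u, v)}))) : StressFree U V S := by
  classical
  intro c hc hcV hcU
  -- Since `u`, `i` coincide and `v`, `j` coincide, `x ⊗ y` is a stress on the 4-cycle `uv`, `uj`,
  -- `iv`, `ij`. Subtracting `c u v` times it from `c` moves the weight of `uv` onto `ij`.
  set x : α → F := Pi.single u 1 - Pi.single i 1 with hx
  set y : β → F := Pi.single v 1 - Pi.single j 1 with hy
  have hxU : ∑ a, x a • U a = 0 := by
    simp [hx, sub_smul, Pi.single_apply, hU]
  have hyV : ∑ b, y b • V b = 0 := by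
    simp [hy, sub_smul, Pi.single_apply, hV]
  have h0 := h (fun a b => c a b - c u v * x a * y b) (fun a b hab => ?_) (fun a => ?_) fun b => ?_
  -- The coefficient at `ij` is `-c u v`, because `ij` is not in `S`; so `c u v = 0` and nothing was
  -- subtracted.
  · have h1 := congrFun (congrFun h0 i) j
    have huv : c u v = 0 := by
      simpa [hx, hy, hui.symm, hvj.symm, hc i j hij] using h1
    simpa [huv] using h0
  · rw [Set.mem_insert_iff, Set.mem_sdiff, Set.mem_singleton_iff, not_or, not_and_not_right] at hab
    by_cases habS : (a, b) ∈ S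
    · have := hab.2 habS
      obtain ⟨rfl, rfl⟩ := Prod.ext_iff.1 this
      simp [hx, hy, hui, hvj]
    · rw [hc a b habS]
      have h1 : (a, b) ≠ (i, j) := hab.1
      by_cases ha : a = i
      · subst ha
        have h2 : b ≠ j := fun h => h1 (by rw [h])
        have h3 : b ≠ v := fun h => habS (h ▸ hiv)
        simp [hy, h2, h3]
      · by_cases ha' : a = u
        · subst ha'
          have h2 : b ≠ j := fun h => habS (h ▸ huj)
          by_cases h3 : b = v
          · subst h3
            simp [hc _ _ habS]
          · simp [hy, h2, h3]
        · simp [hx, ha, ha']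
  · simp_rw [sub_smul, Finset.sum_sub_distrib, hcV, mul_smul, ← Finset.smul_sum, hyV]
    simp
  · have h1 : ∀ a, (c a b - c u v * x a * y b) • U a = c a b • U a - (c u v * y b) • x a • U a :=
      fun a => by rw [sub_smul, smul_smul, mul_right_comm]
    simp_rw [h1, Finset.sum_sub_distrib, hcU, ← Finset.smul_sum, hxU, smul_zero, sub_zero]

/-- The `r²`-dimensional symmetry of the bilinear form bounds the size of a stress-free graph. -/
theorem ncard_le [Fintype κ] (h : StressFree U V S) {R R₀ : Set α} {T : Set β} (hS : S ⊆ R ×ˢ T)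
    (hR₀ : LinearIndepOn F U R₀) :
    S.ncard ≤ Fintype.card κ * ((R \ R₀).ncard + T.ncard) := by
  classical
  -- The equilibrium conditions at all columns and at the rows outside `R₀` already force those on
  -- `R₀`. Hence this map is injective on weights supported on `S`, and its target has the claimed
  -- dimension.
  let Ψ : (α × β → F) →ₗ[F] ((↥(R \ R₀) → κ → F) × (T → κ → F)) :=
    { toFun := fun c => (fun x => ∑ b, c (x, b) • V b, fun y => ∑ a, c (a, y) • U a)
      map_add' := fun c c' => by
        ext <;> simp [add_smul, Finset.sum_add_distrib]
      map_smul' := fun t c => by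
        ext <;> simp [mul_assoc, Finset.mul_sum] }
  let Φ := Ψ ∘ₗ Function.ExtendByZero.linearMap F (Subtype.val : S → α × β)
  have hinj : Function.Injective Φ := by
    rw [← LinearMap.ker_eq_bot, LinearMap.ker_eq_bot']
    intro g hg
    set c : α × β → F := Function.extend Subtype.val g 0 with hcdef
    have hc : ∀ a b, (a, b) ∉ S → c (a, b) = 0 := fun a b hab => by
      rw [hcdef, Function.extend_apply' _ _ _ (by simpa using hab), Pi.zero_apply]
    have hg' : Ψ c = 0 := hg
    have hU : ∀ b, ∑ a, c (a, b) • U a = 0 := by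
      intro b
      by_cases hb : b ∈ T
      · exact congrFun (congrArg Prod.snd hg') ⟨b, hb⟩
      · exact Finset.sum_eq_zero fun a _ => by rw [hc a b fun h => hb (hS h).2, zero_smul]
    have hV₀ : ∀ a ∉ R₀, ∑ b, c (a, b) • V b = 0 := by
      intro a ha
      by_cases haR : a ∈ R
      · exact congrFun (congrArg Prod.fst hg') ⟨a, haR, ha⟩
      · exact Finset.sum_eq_zero fun b _ => by rw [hc a b fun h => haR (hS h).1, zero_smul]
    -- With `w a = ∑ b, c (a, b) • V b`, one has `∑ a, U a ⊗ w a = ∑ b, (∑ a, c (a, b) • U a) ⊗ V b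
    -- = 0`. Only rows in `R₀` contribute on the left, and their `U a` are linearly independent.
    have hV : ∀ a, ∑ b, c (a, b) • V b = 0 := by
      intro a
      ext k
      refine congrFun (hR₀.eq_zero_of_sum_smul_eq_zero
        (g := fun a => (∑ b, c (a, b) • V b) k) (fun a ha => by simp only [hV₀ a ha, Pi.zero_apply]) ?_) a
      ext k'
      have h1 : ∀ b, (∑ a, c (a, b) * U a k') * V b k = 0 := fun b => by
        have := congrFun (hU b) k'
        simp only [Finset.sum_apply, Pi.smul_apply, smul_eq_mul, Pi.zero_apply] at this
        rw [this, zero_mul]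
      simp only [Finset.sum_apply, Pi.smul_apply, smul_eq_mul, Pi.zero_apply, Finset.sum_mul]
      rw [Finset.sum_comm, ← Finset.sum_eq_zero fun b (_ : b ∈ Finset.univ) => h1 b]
      refine Finset.sum_congr rfl fun b _ => ?_
      rw [Finset.sum_mul]
      exact Finset.sum_congr rfl fun a _ => by ring
    have h0 := h (fun a b => c (a, b)) hc hV hU
    ext e
    have h1 : c e.1 = g e := Function.Injective.extend_apply Subtype.val_injective _ _ _
    rw [← h1]
    exact congrFun (congrFun h0 e.1.1) e.1.2
  have hrank := LinearMap.finrank_le_finrank_of_injective hinj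
  rw [Module.finrank_prod, Module.finrank_fintype_fun_eq_card,
    Module.finrank_pi_fintype F (M := fun _ : ↥(R \ R₀) => κ → F),
    Module.finrank_pi_fintype F (M := fun _ : T => κ → F)] at hrank
  simp only [Module.finrank_fintype_fun_eq_card, Finset.sum_const, Finset.card_univ, smul_eq_mul,
    ← Nat.card_eq_fintype_card, Nat.card_coe_set_eq] at hrank ⊢
  linarith

end StressFree

/-! ### Edge counts, the rank, and circuits spanned by a basis. -/

theorem Set.ncard_eq_sum_ite {γ : Type*} [Fintype γ] (T : Set γ) [DecidablePred (· ∈ T)] :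
    T.ncard = ∑ x, if x ∈ T then 1 else 0 := by
  rw [Set.ncard_eq_toFinset_card', Finset.sum_boole]
  simp

theorem Set.ncard_eq_sum_ncard_row {α β : Type*} [Fintype α] [Fintype β] (S : Set (α × β)) :
    S.ncard = ∑ a, {b | (a, b) ∈ S}.ncard := by
  classical
  simp only [Set.ncard_eq_sum_ite, Fintype.sum_prod_type]
  rfl

theorem Set.ncard_eq_sum_ncard_col {α β : Type*} [Fintype α] [Fintype β] (S : Set (α × β)) :
    S.ncard = ∑ b, {a | (a, b) ∈ S}.ncard := by
  classical
  simp only [Set.ncard_eq_sum_ite, Fintype.sum_prod_type_right]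
  rfl

section Rank

variable {K : Type*} [Field K] [CharZero K] {m n r : ℕ}

/-- An independent graph on at least `r` rows has at most `r (k + ℓ - r)` edges. -/
theorem ncard_add_le_of_detMatroid_indep {S : Set (Fin m × Fin n)}
    (hS : (detMatroid K m n r).Indep S) {R : Set (Fin m)} {T : Set (Fin n)} (hRT : S ⊆ R ×ˢ T)
    (hR : r ≤ R.ncard) : S.ncard + r * r ≤ r * (R.ncard + T.ncard) := by
  obtain ⟨R₀, hR₀, hcard⟩ := Set.exists_subset_card_eq hR
  have h := (stressFree_of_indep hS).ncard_le hRT (linearIndepOn_genericU hcard.le)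
  rw [Fintype.card_fin] at h
  have h1 : (R \ R₀).ncard + r = R.ncard := by
    rw [← hcard]
    exact Set.ncard_sdiff_add_ncard_of_subset hR₀
  rw [← h1]
  nlinarith

/-- Every row incident to a circuit has degree at least `r + 1`. -/
theorem lt_ncard_row_of_isCircuit {C : Set (Fin m × Fin n)} (hC : (detMatroid K m n r).IsCircuit C)
    {a : Fin m} {b : Fin n} (hab : (a, b) ∈ C) : r < {b | (a, b) ∈ C}.ncard := by
  -- Removing the row leaves a proper, hence independent, subgraph; a row of degree at most `r`
  -- could be added back without creating a stress.
  by_contra! h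
  refine hC.dep.not_indep (indep_of_stressFree (U := genericU K m n r)
    (V := genericV K m n r) (StressFree.of_row a (linearIndepOn_genericV h)
    (stressFree_of_indep (hC.ssubset_indep ⟨Set.sep_subset _ _, fun hsub => ?_⟩))))
  exact (hsub hab).2 rfl

/-- Every column incident to a circuit has degree at least `r + 1`. -/
theorem lt_ncard_col_of_isCircuit {C : Set (Fin m × Fin n)} (hC : (detMatroid K m n r).IsCircuit C)
    {a : Fin m} {b : Fin n} (hab : (a, b) ∈ C) : r < {a | (a, b) ∈ C}.ncard := by
  by_contra! h
  refine hC.dep.not_indep (indep_of_stressFree (U := genericU K m n r)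
    (V := genericV K m n r) (StressFree.of_col b (linearIndepOn_genericU h)
    (stressFree_of_indep (hC.ssubset_indep ⟨Set.sep_subset _ _, fun hsub => ?_⟩))))
  exact (hsub hab).2 rfl

/-- The rank of the determinantal matroid is at least `r (m + n - r)`. -/
theorem le_ncard_add_of_isBase {B : Set (Fin m × Fin n)} (hB : (detMatroid K m n r).IsBase B)
    (hm : r ≤ m) (hn : r ≤ n) : r * (m + n) ≤ B.ncard + r * r := by
  obtain ⟨p, rfl⟩ := Nat.exists_eq_add_of_le hm
  obtain ⟨q, rfl⟩ := Nat.exists_eq_add_of_le hn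
  -- The hook of the first `r` rows and first `r` columns: once the rows beyond `r` are peeled,
  -- every column has at most `r` neighbours.
  set S : Set (Fin (r + p) × Fin (r + q)) := {e | (e.1 : ℕ) < r ∨ (e.2 : ℕ) < r} with hSdef
  have hlt : ∀ s, {b : Fin (r + s) | (b : ℕ) < r}.ncard = r := by
    intro s
    have h1 : {b : Fin (r + s) | (b : ℕ) < r} = Set.range (Fin.castAdd s) := by
      ext b
      exact ⟨fun h => ⟨⟨b, h⟩, rfl⟩, by rintro ⟨x, rfl⟩; exact x.2⟩
    rw [h1, ← Set.image_univ, Set.ncard_image_of_injective _ (Fin.castAdd_injective _ _),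
      Set.ncard_univ, Nat.card_fin]
  have hS : (detMatroid K (r + p) (r + q) r).Indep S := by
    refine indep_of_stressFree (U := genericU K _ _ r) (V := genericV K _ _ r)
      (StressFree.of_rows {a | ¬ (a : ℕ) < r} (fun a ha => linearIndepOn_genericV ?_)
      (StressFree.of_cols Set.univ (fun b _ => linearIndepOn_genericU ?_)
      (StressFree.empty.mono fun e he => he.2 (Set.mem_univ _))))
    · refine le_of_eq_of_le (congrArg Set.ncard ?_) (hlt q).le
      ext b
      exact or_iff_right ha
    · refine (Set.ncard_le_ncard (fun a ha => ?_)).trans (hlt p).le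
      exact not_not.1 ha.2
  have hcard : S.ncard = r * (r + q) + p * r := by
    rw [Set.ncard_eq_sum_ncard_row, Fin.sum_univ_add]
    have h1 : ∀ a : Fin r, {b | (Fin.castAdd p a, b) ∈ S}.ncard = r + q := fun a => by
      have : {b | (Fin.castAdd p a, b) ∈ S} = Set.univ :=
        Set.eq_univ_of_forall fun b => Or.inl a.2
      rw [this, Set.ncard_univ, Nat.card_fin]
    have h2 : ∀ a : Fin p, {b | (Fin.natAdd r a, b) ∈ S}.ncard = r := fun a => by
      have : {b | (Fin.natAdd r a, b) ∈ S} = {b : Fin (r + q) | (b : ℕ) < r} := by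
        ext b
        simp [hSdef]
      rw [this, hlt]
    simp [h1, h2]
  obtain ⟨B', hB', hsub⟩ := hS.exists_isBase_superset
  have h1 := Set.ncard_le_ncard hsub
  rw [hB'.ncard_eq_ncard_of_isBase hB] at h1
  nlinarith

/-- The size of a circuit that is spanned by a basis. -/
theorem le_ncard_of_isCircuit_of_spannedByBasis {C : Set (Fin m × Fin n)}
    (hC : (detMatroid K m n r).IsCircuit C) (hspan : SpannedByBasis (detMatroid K m n r) C) :
    r < m ∧ r < n ∧ r * (m + n) + 1 ≤ C.ncard + r * r := by
  obtain ⟨⟨a, b⟩, hab⟩ := hC.nonempty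
  have hm : r < m := (lt_ncard_col_of_isCircuit hC hab).trans_le
    ((Set.ncard_le_card _).trans_eq (Nat.card_fin m))
  have hn : r < n := (lt_ncard_row_of_isCircuit hC hab).trans_le
    ((Set.ncard_le_card _).trans_eq (Nat.card_fin n))
  refine ⟨hm, hn, ?_⟩
  obtain ⟨B, hB, hBC⟩ := hspan
  have h1 := le_ncard_add_of_isBase hB hm.le hn.le
  have h2 : B.ncard < C.ncard := Set.ncard_lt_ncard
    ⟨hBC, fun h => hC.dep.not_indep (hB.indep.subset h)⟩
  omega

/-- A graph with `r (m + n - r) + 1` edges all of whose edge-deleted subgraphs are independent is a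
circuit spanned by a basis. -/
theorem isCircuit_and_spannedByBasis {D : Set (Fin m × Fin n)} (hm : r ≤ m)
    (hcard : r * (m + n) + 1 ≤ D.ncard + r * r) (hne : D.Nonempty)
    (hD : ∀ e ∈ D, (detMatroid K m n r).Indep (D \ {e})) :
    (detMatroid K m n r).IsCircuit D ∧ SpannedByBasis (detMatroid K m n r) D := by
  have hbound : ∀ S, (detMatroid K m n r).Indep S → S.ncard + r * r ≤ r * (m + n) := fun S hS => by
    simpa [Set.ncard_univ] using ncard_add_le_of_detMatroid_indep hS (R := Set.univ)
      (T := Set.univ) (by simp) (by simpa [Set.ncard_univ] using hm)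
  constructor
  · rw [Matroid.isCircuit_iff_dep_forall_sdiff_singleton_indep]
    refine ⟨⟨fun h => ?_, by simp [detMatroid]⟩, hD⟩
    have := hbound D h
    omega
  · obtain ⟨e, he⟩ := hne
    -- The graph `D` minus `e` already has the largest size of an independent set, so it is itself a
    -- basis.
    obtain ⟨B, hB, hsub⟩ := (hD e he).exists_isBase_superset
    have h1 := hbound B hB.indep
    have h2 := Set.ncard_sdiff_singleton_add_one he
    have h3 := Set.eq_of_subset_of_ncard_le hsub (by omega)
    exact ⟨B, hB, h3 ▸ Set.sdiff_subset⟩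

end Rank

/-! ### The effect of a single move. -/

section Move

variable {K : Type*} [Field K] [CharZero K] {m n r t : ℕ}

/-- The number of edges after a `(t,1)`-move. -/
theorem IsT1Move.ncard_eq {C : Set (Fin m × Fin n)} {i : Fin m} {j : Fin n}
    {D : Set (Fin (m + 1) × Fin (n + t))} (h : IsT1Move r t C i j D) :
    D.ncard = C.ncard + r * (t + 1) := by
  classical
  have h1 := h.degree_new_row
  have h2 := h.degree_new_col
  have h3 := Set.ncard_sdiff_singleton_add_one h.edge_mem
  have h4 : ∀ a b, (a, b) ∈ C \ {(i, j)} ↔ (a.castSucc, Fin.castAdd t b) ∈ D := fun a b =>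
    (h.old_edges a b).symm
  -- The new columns contribute `t (r + 1)`, the new row contributes `r + 1 - t` edges to old
  -- columns, and `ij` is lost.
  simp only [Set.ncard_eq_sum_ite, Fintype.sum_prod_type_right, Fin.sum_univ_add,
    Fin.sum_univ_castSucc, Set.mem_ofPred_eq, h.new_edges, if_true, Finset.sum_const,
    Finset.card_univ, Fintype.card_fin, smul_eq_mul, mul_one, Finset.sum_add_distrib, h4,
    add_left_inj] at h1 h2 h3 ⊢
  simp only [h2, Finset.sum_const, Finset.card_univ, Fintype.card_fin, smul_eq_mul]
  linarith

/-- Removing the new vertices of a `(t,1)`-move, beginning with the new column `q`. -/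
theorem StressFree.of_new_vertices {F : Type*} [Field F] {U : Fin (m + 1) → Fin r → F}
    {V : Fin (n + t) → Fin r → F} {S : Set (Fin (m + 1) × Fin (n + t))} (T : Set (Fin (n + t)))
    (hv : ∀ v ∈ T, LinearIndepOn F U {a | (a, v) ∈ S})
    (hu : LinearIndepOn F V {b | (Fin.last m, b) ∈ S ∧ b ∉ T})
    (hcol : ∀ q, LinearIndepOn F U {a | (a, Fin.natAdd n q) ∈ S ∧ a ≠ Fin.last m})
    (hold : StressFree U V {e ∈ S | e.1 ≠ Fin.last m ∧ ∀ q : Fin t, e.2 ≠ Fin.natAdd n q}) :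
    StressFree U V S := by
  -- In this order the new row needs independent neighbours only outside `T`, and the remaining new
  -- columns only after the new row is gone.
  refine StressFree.of_cols T hv (StressFree.of_row (Fin.last m) (hu.mono fun b hb => hb)
    (StressFree.of_cols (Set.range (Fin.natAdd n)) ?_ (hold.mono fun e he => ?_)))
  · rintro _ ⟨q, rfl⟩
    exact (hcol q).mono fun a ha => ⟨ha.1.1, ha.2⟩
  · exact ⟨he.1.1.1, he.1.2, fun q hq => he.2 ⟨q, hq.symm⟩⟩

/-- All new vertices have degree `r + 1`, so each can be peeled once it has lost one edge, and
peeling one frees the next because of the edges `uv_q`. When only an old edge is deleted, the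
exchange of `uv` for `ij` starts this process. -/
theorem IsT1Move.indep_sdiff_singleton {C : Set (Fin m × Fin n)} {i : Fin m} {j : Fin n}
    {D : Set (Fin (m + 1) × Fin (n + t))} (h : IsT1Move r t C i j D)
    (hC : (detMatroid K m n r).IsCircuit C) {e : Fin (m + 1) × Fin (n + t)} (he : e ∈ D) :
    (detMatroid K (m + 1) (n + t) r).Indep (D \ {e}) := by
  set U := genericU K (m + 1) (n + t) r
  set V := genericV K (m + 1) (n + t) r
  have hold : ∀ e₀ ∈ C, StressFree U V
      (Prod.map Fin.castSucc (Fin.castAdd t) '' (C \ {e₀})) := fun e₀ he₀ =>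
    stressFree_of_indep ((detMatroid_indep_image_iff (Fin.castSucc_injective m)
      (Fin.castAdd_injective n t) _).2 (hC.sdiff_singleton_indep he₀))
  have hrow : ∀ N ⊆ {b | (Fin.last m, b) ∈ D}, ∀ x, (Fin.last m, x) ∈ D → x ∉ N →
      N.ncard ≤ r := fun N hN x hx hxN => by
    have h1 := Set.ncard_lt_ncard (s := N) ⟨hN, fun hsub => hxN (hsub hx)⟩
    rw [h.degree_new_row] at h1
    omega
  have hcol : ∀ q, ∀ N ⊆ {a | (a, Fin.natAdd n q) ∈ D}, ∀ x, (x, Fin.natAdd n q) ∈ D → x ∉ N →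
      N.ncard ≤ r := fun q N hN x hx hxN => by
    have h1 := Set.ncard_lt_ncard (s := N) ⟨hN, fun hsub => hxN (hsub hx)⟩
    rw [h.degree_new_col] at h1
    omega
  have hcol' : ∀ q, ∀ N ⊆ {a | (a, Fin.natAdd n q) ∈ D}, Fin.last m ∉ N → N.ncard ≤ r :=
    fun q N hN hx => hcol q N hN _ (h.new_edges q) hx
  obtain ⟨x, y⟩ := e
  have hlast : ∀ (x : Fin (m + 1)), x ≠ Fin.last m → ∃ a, x = Fin.castSucc a :=
    fun x hx => ⟨x.castPred hx, (Fin.castSucc_castPred x hx).symm⟩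
  have hnew : ∀ y : Fin (n + t), (∀ q : Fin t, y ≠ Fin.natAdd n q) → ∃ b, y = Fin.castAdd t b := by
    intro y
    refine Fin.addCases (fun b _ => ⟨b, rfl⟩) (fun q hq => absurd rfl (hq q)) y
  have hrest : ∀ S ⊆ D, StressFree U V
      {e ∈ S | e.1 ≠ Fin.last m ∧ ∀ q : Fin t, e.2 ≠ Fin.natAdd n q} := by
    refine fun S hS => (hold (i, j) h.edge_mem).mono ?_
    rintro ⟨x, y⟩ ⟨hxy, hx, hy⟩
    obtain ⟨a, rfl⟩ := hlast x hx
    obtain ⟨b, rfl⟩ := hnew y hy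
    exact ⟨(a, b), (h.old_edges a b).1 (hS hxy), rfl⟩
  by_cases hx : x = Fin.last m
  · subst hx
    -- The new row has lost an edge and goes first; each new column then loses its edge to that row.
    refine indep_of_stressFree (U := U) (V := V) (StressFree.of_new_vertices ∅ (by simp) (linearIndepOn_genericV
      (hrow _ (fun b hb => hb.1.1) y he fun hy => hy.1.2 rfl)) (fun q => linearIndepOn_genericU
      (hcol' q _ (fun a ha => ha.1.1) fun ha => ha.2 rfl)) (hrest _ Set.sdiff_subset))
  obtain ⟨a₀, rfl⟩ := hlast x hx
  by_cases hy : ∃ q : Fin t, y = Fin.natAdd n q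
  · obtain ⟨q, rfl⟩ := hy
    -- The damaged column goes first, then the new row, then the other new columns.
    refine indep_of_stressFree (U := U) (V := V) (StressFree.of_new_vertices {Fin.natAdd n q} ?_
      (linearIndepOn_genericV (hrow _ (fun b hb => hb.1.1) (Fin.natAdd n q) (h.new_edges q)
      fun hy => hy.2 rfl)) (fun q => linearIndepOn_genericU
      (hcol' q _ (fun a ha => ha.1.1) fun ha => ha.2 rfl)) (hrest _ Set.sdiff_subset))
    rintro _ rfl
    exact linearIndepOn_genericU (hcol q _ (fun a ha => ha.1) _ he fun ha => ha.2 rfl)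
  push Not at hy
  obtain ⟨b₀, rfl⟩ := hnew y hy
  obtain ⟨hab, habij⟩ := (h.old_edges a₀ b₀).1 he
  obtain ⟨q, huj, hiv, -⟩ := h.pair
  have hqj : Fin.natAdd n q ≠ Fin.castAdd t j := fun hq => by
    have := congrArg Fin.val hq
    simp at this
    omega
  -- The special position for the exchange. In the subsequent peeling no neighbourhood contains a
  -- moved vertex: `uv` has been exchanged away, and `v` is peeled before `u`. So the independence
  -- of generic points still applies.
  set U' := Function.update U (Fin.last m) (U i.castSucc)
  set V' := Function.update V (Fin.natAdd n q) (V (Fin.castAdd t j))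
  have hU' : ∀ a, a ≠ Fin.last m → U' a = U a := fun a ha => Function.update_of_ne ha _ _
  have hV' : ∀ b, b ≠ Fin.natAdd n q → V' b = V b := fun b hb => Function.update_of_ne hb _ _
  have hli : i.castSucc ≠ Fin.last m := Fin.castSucc_ne_last i
  have hU'' : ∀ N : Set (Fin (m + 1)), N.ncard ≤ r → Fin.last m ∉ N → LinearIndepOn _ U' N :=
    fun N hN hlN => (linearIndepOn_genericU hN).congr fun a ha =>
      (hU' a fun h => hlN (h ▸ ha)).symm
  have hV'' : ∀ N : Set (Fin (n + t)), N.ncard ≤ r → Fin.natAdd n q ∉ N → LinearIndepOn _ V' N :=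
    fun N hN hlN => (linearIndepOn_genericV hN).congr fun a ha =>
      (hV' a fun h => hlN (h ▸ ha)).symm
  have hD : ∀ {a b}, (a, b) ∈ insert (i.castSucc, Fin.castAdd t j)
      ((D \ {(a₀.castSucc, Fin.castAdd t b₀)}) \ {(Fin.last m, Fin.natAdd n q)}) →
      (a = Fin.last m ∨ ∃ q, b = Fin.natAdd n q) →
      (a, b) ∈ D ∧ (a, b) ≠ (Fin.last m, Fin.natAdd n q) := by
    rintro a b (hab | hab) hor
    · obtain ⟨rfl, rfl⟩ := Prod.ext_iff.1 hab
      rcases hor with hor | ⟨q', hor⟩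
      · exact absurd hor hli
      · have := congrArg Fin.val hor
        simp at this
        omega
    · exact ⟨hab.1.1, hab.2⟩
  refine indep_of_stressFree (U := U') (V := V') (StressFree.of_exchange (u := Fin.last m)
    (i := i.castSucc) (v := Fin.natAdd n q) (j := Fin.castAdd t j) hli.symm hqj ?_ ?_ ?_ ?_ ?_
    (StressFree.of_new_vertices {Fin.natAdd n q} ?_ ?_ (fun q' => ?_) ?_))
  · rw [hU' _ hli]
    exact Function.update_self _ _ _
  · rw [hV' _ hqj.symm]
    exact Function.update_self _ _ _
  · exact ⟨huj, fun h => hx (congrArg Prod.fst h).symm⟩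
  · exact ⟨hiv, fun h => hy q (congrArg Prod.snd h).symm⟩
  · exact fun hij => ((h.old_edges i j).1 hij.1).2 rfl
  · rintro _ rfl
    exact hU'' _ (hcol' q _ (fun a ha => (hD ha (Or.inr ⟨q, rfl⟩)).1)
      fun ha => (hD ha (Or.inl rfl)).2 rfl) fun ha => (hD ha (Or.inl rfl)).2 rfl
  · exact hV'' _ (hrow _ (fun b hb => (hD hb.1 (Or.inl rfl)).1) _ (h.new_edges q)
      fun hb => hb.2 rfl) fun hb => hb.2 rfl
  · exact hU'' _ (hcol' q' _ (fun a ha => (hD ha.1 (Or.inr ⟨q', rfl⟩)).1) fun ha => ha.2 rfl)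
      fun ha => ha.2 rfl
  · refine ((hold (a₀, b₀) hab).mono ?_).congr (fun e he => hU' _ he.2.1) fun e he =>
      hV' _ (he.2.2 q)
    rintro ⟨x, y⟩ ⟨hxy, hx, hy⟩
    obtain ⟨a, rfl⟩ := hlast x hx
    obtain ⟨b, rfl⟩ := hnew y hy
    refine ⟨(a, b), ?_, rfl⟩
    rcases hxy with hxy | hxy
    · rw [Prod.mk.injEq, Fin.castSucc_inj, Fin.castAdd_inj] at hxy
      obtain ⟨rfl, rfl⟩ := hxy
      exact ⟨h.edge_mem, fun h => habij h.symm⟩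
    · refine ⟨((h.old_edges a b).1 hxy.1.1).1, fun hab => hxy.1.2 ?_⟩
      obtain ⟨rfl, rfl⟩ := Prod.ext_iff.1 hab
      rfl

/-- A `(t,1)`-move preserves circuits that are spanned by a basis. -/
theorem IsT1Move.isCircuit_and_spannedByBasis {C : Set (Fin m × Fin n)} {i : Fin m} {j : Fin n}
    {D : Set (Fin (m + 1) × Fin (n + t))} (h : IsT1Move r t C i j D)
    (hC : (detMatroid K m n r).IsCircuit C) (hspan : SpannedByBasis (detMatroid K m n r) C) :
    (detMatroid K (m + 1) (n + t) r).IsCircuit D ∧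
      SpannedByBasis (detMatroid K (m + 1) (n + t) r) D := by
  obtain ⟨hm, hn, hcard⟩ := le_ncard_of_isCircuit_of_spannedByBasis hC hspan
  obtain ⟨q, hq, -⟩ := h.pair
  refine _root_.isCircuit_and_spannedByBasis (by omega) ?_ ⟨_, hq⟩ fun e he =>
    h.indep_sdiff_singleton hC he
  -- The added `r (t + 1)` edges match the growth from `r (m + n - r)` to `r ((m + 1) + (n + t) -
  -- r)`.
  rw [h.ncard_eq]
  nlinarith

end Move

/-! ### Iterated moves from the complete bipartite graph, and signatures. -/

/-- The complete bipartite graph `K_{r+1,r+1}` is a circuit spanned by a basis. -/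
theorem isCircuit_and_spannedByBasis_univ (K : Type*) [Field K] [CharZero K] (r : ℕ) :
    (detMatroid K (r + 1) (r + 1) r).IsCircuit Set.univ ∧
      SpannedByBasis (detMatroid K (r + 1) (r + 1) r) Set.univ := by
  refine isCircuit_and_spannedByBasis (by omega) ?_ Set.univ_nonempty fun e _ => ?_
  · simp only [Set.ncard_univ, Nat.card_prod, Nat.card_fin]
    nlinarith
  · have hcard : ∀ (x : Fin (r + 1)) (N : Set (Fin (r + 1))), x ∉ N → N.ncard ≤ r := by
      intro x N hx
      have h1 := Set.ncard_lt_card (s := N) fun h => hx (h ▸ Set.mem_univ x)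
      rw [Nat.card_fin] at h1
      omega
    refine indep_of_stressFree (U := genericU K _ _ r) (V := genericV K _ _ r)
      (StressFree.of_row e.1 (linearIndepOn_genericV (hcard e.2 _ fun h => h.2 rfl))
      (StressFree.of_cols Set.univ (fun b _ => linearIndepOn_genericU
        (hcard e.1 _ fun h => h.2 rfl)) (StressFree.empty.mono fun e he => he.2 (Set.mem_univ _))))

theorem signature_image {α β γ δ : Type*} {f : α → γ} {g : β → δ} (hf : f.Injective)
    (hg : g.Injective) (S : Set (α × β)) : signature (Prod.map f g '' S) = signature S := by
  have h1 : Prod.fst '' (Prod.map f g '' S) = f '' (Prod.fst '' S) := by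
    simp only [Set.image_image, Prod.map_fst]
  have h2 : Prod.snd '' (Prod.map f g '' S) = g '' (Prod.snd '' S) := by
    simp only [Set.image_image, Prod.map_snd]
  rw [signature, signature, h1, h2, Set.ncard_image_of_injective _ hf,
    Set.ncard_image_of_injective _ hg]

/-- The graphs obtained from `K_{r+1,r+1}` by `s` successive `(r,1)`-moves. -/
theorem IteratedT1Move.properties {K : Type*} [Field K] [CharZero K] {r s m n : ℕ}
    {C : Set (Fin m × Fin n)}
    (h : IteratedT1Move r r (Set.univ : Set (Fin (r + 1) × Fin (r + 1))) s C) :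
    ((detMatroid K m n r).IsCircuit C ∧ SpannedByBasis (detMatroid K m n r) C) ∧
      (m = r + 1 + s ∧ n = r * (s + 1) + 1) ∧
        Prod.fst '' C = Set.univ ∧ Prod.snd '' C = Set.univ := by
  induction h with
  | refl =>
    refine ⟨isCircuit_and_spannedByBasis_univ K r, ⟨by omega, by ring⟩, ?_, ?_⟩
    · rw [Set.image_univ, Set.range_eq_univ]
      exact Prod.fst_surjective
    · rw [Set.image_univ, Set.range_eq_univ]
      exact Prod.snd_surjective
  | @step s m n C i j D _ hmove ih =>
    obtain ⟨hC, ⟨hm, hn⟩, h1, h2⟩ := ih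
    obtain ⟨q, huj, hiv, -⟩ := hmove.pair
    refine ⟨hmove.isCircuit_and_spannedByBasis hC.1 hC.2, ⟨by omega, by rw [hn]; ring⟩,
      Set.eq_univ_of_forall fun x => ?_, Set.eq_univ_of_forall fun y => ?_⟩
    · induction x using Fin.lastCases with
      | last => exact ⟨_, huj, rfl⟩
      | cast a =>
        obtain ⟨⟨a', b⟩, hab, rfl⟩ := h1.symm.subset (Set.mem_univ a)
        -- Losing `ij` cannot isolate `i` or `j`, as the move supplies `iv` and `uj`.
        by_cases hij : (a', b) = (i, j)
        · obtain ⟨rfl, rfl⟩ := Prod.ext_iff.1 hij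
          exact ⟨_, hiv, rfl⟩
        · exact ⟨_, (hmove.old_edges a' b).2 ⟨hab, hij⟩, rfl⟩
    · induction y using Fin.addCases with
      | right q => exact ⟨_, hmove.new_edges q, rfl⟩
      | left b =>
        obtain ⟨⟨a, b'⟩, hab, rfl⟩ := h2.symm.subset (Set.mem_univ b)
        by_cases hij : (a, b') = (i, j)
        · obtain ⟨rfl, rfl⟩ := Prod.ext_iff.1 hij
          exact ⟨_, huj, rfl⟩
        · exact ⟨_, (hmove.old_edges a b').2 ⟨hab, hij⟩, rfl⟩

theorem IteratedT1Move.signature_eq {r s m n : ℕ} {C : Set (Fin m × Fin n)}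
    (h : IteratedT1Move r r (Set.univ : Set (Fin (r + 1) × Fin (r + 1))) s C) :
    signature C = (r + 1 + s, r * (s + 1) + 1) := by
  -- The signature does not depend on a field, so any field of characteristic zero serves.
  obtain ⟨-, ⟨hm, hn⟩, h1, h2⟩ := h.properties (K := ℚ)
  rw [signature, h1, h2, Set.ncard_univ, Set.ncard_univ, Nat.card_fin, Nat.card_fin, ← hm, ← hn]

/-- An `(r,1)`-move over `ij` is possible if `i` has degree at least two and `j` has degree at
least `r + 1`. -/
theorem exists_isT1Move {r m n : ℕ} (hr : 1 ≤ r) {C : Set (Fin m × Fin n)} {i : Fin m} {j : Fin n}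
    (hij : (i, j) ∈ C) (hi : 1 < {b | (i, b) ∈ C}.ncard) (hj : r < {a | (a, j) ∈ C}.ncard) :
    ∃ D : Set (Fin (m + 1) × Fin (n + r)), IsT1Move r r C i j D := by
  classical
  -- Every new column is joined to the new row and to `A`; the new row is joined to `j` and the `r`
  -- new columns. All new degrees are then `r + 1`, and the degree assumptions make `{j}` and `A`
  -- proper in the neighbourhoods of `i` and `j`.
  obtain ⟨A, hiA, hAj, hA⟩ := Set.exists_subsuperset_card_eq (s := {i}) (t := {a | (a, j) ∈ C})
    (n := r) (by simpa using hij) (by simpa using hr) hj.le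
  let D : Set (Fin (m + 1) × Fin (n + r)) := {e |
    Fin.addCases (motive := fun _ => Prop)
      (fun b => Fin.lastCases (motive := fun _ => Prop) (b = j)
        (fun a => (a, b) ∈ C ∧ (a, b) ≠ (i, j)) e.1)
      (fun _ => Fin.lastCases (motive := fun _ => Prop) True (fun a => a ∈ A) e.1) e.2}
  have h1 : ∀ a b, (a.castSucc, Fin.castAdd r b) ∈ D ↔ (a, b) ∈ C ∧ (a, b) ≠ (i, j) := by
    intro a b
    simp [D]
  have h2 : ∀ b, (Fin.last m, Fin.castAdd r b) ∈ D ↔ b = j := by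
    intro b
    simp [D]
  have h3 : ∀ q, (Fin.last m, Fin.natAdd n q) ∈ D := by
    intro q
    simp [D]
  have h4 : ∀ a q, (a.castSucc, Fin.natAdd n q) ∈ D ↔ a ∈ A := by
    intro a q
    simp [D]
  refine ⟨D, le_rfl, hij, h1, h3, ?_, fun q => ?_, ⟨0, hr⟩, (h2 j).2 rfl,
    (h4 i _).2 (hiA rfl), ?_, ?_⟩
  · simp only [Set.ncard_eq_sum_ite, Fin.sum_univ_add, Set.mem_ofPred_eq, h2, h3]
    simp [add_comm]
  · rw [Set.ncard_eq_sum_ite] at hA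
    simp only [Set.ncard_eq_sum_ite, Fin.sum_univ_castSucc, Set.mem_ofPred_eq, h3, h4, hA, if_true]
  · simp only [h2]
    refine ⟨fun b hb => by rwa [show b = j from hb], fun hsub => ?_⟩
    have := Set.ncard_le_ncard hsub
    simp only [Set.ofPred_eq_eq_singleton, Set.ncard_singleton] at this
    omega
  · simp only [h4, Set.ofPred_mem_eq]
    refine ⟨hAj, fun hsub => ?_⟩
    have := Set.ncard_le_ncard hsub
    omega

/-- The edge with both end degrees above `r` keeps the induction going: after a move, any edge
between the new row and a new column is of this kind. -/
theorem exists_iteratedT1Move {r : ℕ} (hr : 1 ≤ r) (s : ℕ) :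
    ∃ (m n : ℕ) (C : Set (Fin m × Fin n)),
      IteratedT1Move r r (Set.univ : Set (Fin (r + 1) × Fin (r + 1))) s C ∧
        ∃ i j, (i, j) ∈ C ∧ r < {b | (i, b) ∈ C}.ncard ∧ r < {a | (a, j) ∈ C}.ncard := by
  induction s with
  | zero =>
    refine ⟨_, _, _, IteratedT1Move.refl, 0, 0, Set.mem_univ _, ?_, ?_⟩ <;> simp [Set.ncard_univ]
  | succ s ih =>
    obtain ⟨m, n, C, hC, i, j, hij, hi, hj⟩ := ih
    obtain ⟨D, hD⟩ := exists_isT1Move hr hij (by omega) hj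
    refine ⟨_, _, D, hC.step hD, Fin.last m, Fin.natAdd n ⟨0, hr⟩, hD.new_edges _, ?_, ?_⟩
    · rw [hD.degree_new_row]
      omega
    · rw [hD.degree_new_col]
      omega

theorem detMatroid_isCircuit_image_iff {K : Type*} [Field K] {m n m' n' r : ℕ}
    {f : Fin m → Fin m'} (hf : f.Injective) {g : Fin n → Fin n'} (hg : g.Injective)
    (C : Set (Fin m × Fin n)) :
    (detMatroid K m' n' r).IsCircuit (Prod.map f g '' C) ↔ (detMatroid K m n r).IsCircuit C := by
  have hE : ∀ m n, (detMatroid K m n r).E = Set.univ := by simp [detMatroid]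
  rw [Matroid.isCircuit_iff_dep_forall_sdiff_singleton_indep,
    Matroid.isCircuit_iff_dep_forall_sdiff_singleton_indep, Matroid.Dep, Matroid.Dep, hE, hE,
    detMatroid_indep_image_iff hf hg, Set.forall_mem_image]
  simp only [Set.subset_univ, and_true, ← Set.image_singleton,
    ← Set.image_sdiff (hf.prodMap hg), detMatroid_indep_image_iff hf hg]

/-- The signature `(k, ℓ)` of a circuit satisfies `ℓ ≤ r (k - r) + 1`. -/
theorem signature_snd_le_of_isCircuit {K : Type*} [Field K] [CharZero K] {m n r : ℕ}
    {C : Set (Fin m × Fin n)} (hC : (detMatroid K m n r).IsCircuit C) :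
    (signature C).2 + r * r ≤ r * (signature C).1 + 1 := by
  obtain ⟨⟨a, b⟩, hab⟩ := hC.nonempty
  have hsub : C ⊆ (Prod.fst '' C) ×ˢ (Prod.snd '' C) := fun e he =>
    ⟨Set.mem_image_of_mem _ he, Set.mem_image_of_mem _ he⟩
  have hR : r ≤ (Prod.fst '' C).ncard :=
    (lt_ncard_col_of_isCircuit hC hab).le.trans (Set.ncard_le_ncard fun a ha => ⟨_, ha, rfl⟩)
  have h1 := ncard_add_le_of_detMatroid_indep (hC.sdiff_singleton_indep hab)
    (Set.sdiff_subset.trans hsub) hR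
  have h2 := Set.ncard_sdiff_singleton_add_one hab
  have h3 : (r + 1) * (Prod.snd '' C).ncard ≤ C.ncard := by
    classical
    rw [Set.ncard_eq_sum_ncard_col C, Set.ncard_eq_sum_ite, Finset.mul_sum]
    refine Finset.sum_le_sum fun b _ => ?_
    split_ifs with hb
    · obtain ⟨⟨a, b⟩, hab, rfl⟩ := hb
      rw [mul_one]
      exact lt_ncard_col_of_isCircuit hC hab
    · simp
  simp only [signature]
  -- With `(k, ℓ)` the signature, `(r + 1) ℓ ≤ |C| ≤ r (k + ℓ - r) + 1`, and `r ℓ` cancels.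
  nlinarith

theorem mainTheorem9 (K : Type*) [Field K] [CharZero K] :
    -- a `(t,1)`-move over any edge preserves circuit graphs that are spanned by a basis graph
    (∀ (r t m n : ℕ) (C : Set (Fin m × Fin n)),
      (detMatroid K m n r).IsCircuit C → SpannedByBasis (detMatroid K m n r) C →
      ∀ (i : Fin m) (j : Fin n) (D : Set (Fin (m + 1) × Fin (n + t))), IsT1Move r t C i j D →
        (detMatroid K (m + 1) (n + t) r).IsCircuit D ∧
          SpannedByBasis (detMatroid K (m + 1) (n + t) r) D) ∧
    -- iterating the `(r,1)`-move from `K_{r+1,r+1}` is possible `s` times, and yields circuit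
    -- graphs of signature `(k, r (k - r) + 1)` with `k = r + 1 + s`
    (∀ (r s : ℕ), 1 ≤ r →
      (∃ (m n : ℕ) (C : Set (Fin m × Fin n)),
        IteratedT1Move r r (Set.univ : Set (Fin (r + 1) × Fin (r + 1))) s C) ∧
      ∀ (m n : ℕ) (C : Set (Fin m × Fin n)),
        IteratedT1Move r r (Set.univ : Set (Fin (r + 1) × Fin (r + 1))) s C →
          (detMatroid K m n r).IsCircuit C ∧ SpannedByBasis (detMatroid K m n r) C ∧
            signature C = (r + 1 + s, r * (s + 1) + 1)) ∧
    -- the bound `ℓ ≤ r (k - r) + 1` holds for all circuits of `D(m × ℕ, r)`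
    (∀ (m r : ℕ) (C : Set (Fin m × ℕ)), IsLimitCircuit K m r C →
      ((signature C).2 : ℤ) ≤ r * (((signature C).1 : ℤ) - r) + 1) ∧
    -- and it is attained for every `k` with `r + 1 ≤ k ≤ m`
    (∀ (m r k : ℕ), 1 ≤ r → r + 1 ≤ k → k ≤ m →
      ∃ C : Set (Fin m × ℕ), IsLimitCircuit K m r C ∧
        signature C = (k, r * (k - r) + 1)) := by
  refine ⟨fun r t m n C hC hspan i j D hD => hD.isCircuit_and_spannedByBasis hC hspan,
    fun r s hr => ⟨?_, fun m n C hC => ?_⟩, ?_, fun m r k hr hrk hkm => ?_⟩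
  · obtain ⟨m, n, C, hC, -⟩ := exists_iteratedT1Move hr s
    exact ⟨m, n, C, hC⟩
  · have h := (hC.properties (K := K)).1
    exact ⟨h.1, h.2, hC.signature_eq⟩
  · rintro m r _ ⟨ν, C, hC, rfl⟩
    rw [signature_image Function.injective_id Fin.val_injective]
    have h := signature_snd_le_of_isCircuit hC
    zify at h
    linarith
  · obtain ⟨s, rfl⟩ := Nat.exists_eq_add_of_le hrk
    obtain ⟨m', n, C, hC, -⟩ := exists_iteratedT1Move hr s
    obtain ⟨⟨hcirc, -⟩, ⟨rfl, -⟩, -⟩ := hC.properties (K := K)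
    refine ⟨_, ⟨n, _, (detMatroid_isCircuit_image_iff (Fin.castLE_injective hkm)
      Function.injective_id C).2 hcirc, rfl⟩, ?_⟩
    rw [signature_image Function.injective_id Fin.val_injective,
      signature_image (Fin.castLE_injective hkm) Function.injective_id, hC.signature_eq]
    -- Here `k = r + 1 + s`, so the natural subtraction `k - r` is `s + 1`.
    congr 3
    omega
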